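/- Let $A=\mathbb{C}[\partial_1,\dots,\partial_n]$ act by differentiation on the space $\mathcal{D}'$ of complex-valued distributions on $\mathbb{R}^n$, let $\mathcal{F}\subset\mathcal{D}'$ be an $A$-submodule, let $k\ge 0$, and let $P\subset A^k$ be a submodule. Put $$\mathsf{Ker}_{\mathcal F}(P)=\Big\{(f_1,\dots,f_k)\in\mathcal{F}^k \;:\; \sum_{j=1}^k p_j(\partial)f_j=0 \text{ for all } (p_1,\dots,p_k)\in P\Big\}.$$ For $U\subset V\subset\mathbb{R}^n$, a cutoff of a distribution $f$ with respect to $U\subset V$ is a distribution $f_c$ that equals $f$ on some neighbourhood of $U$ and equals $0$ on the complement of $V$ (that is, $f_c(\varphi)=0$ for every test function $\varphi$ supported in $\mathbb{R}^n\setminus V$); cutoffs of tuples are taken entry by entry. The pair $U\subset V$ is admissible with respect to $\mathcal{F}$ if every $f\in\mathcal{F}$ has a cutoff in $\mathcal{F}$ with respect to it. The system $\mathsf{Ker}_{\mathcal F}(P)$ is controllable if, for every pair $U\subset V$ admissible with respect to $\mathcal{F}$, every $f\in\mathsf{Ker}_{\mathcal F}(P)$ has a cutoff in $\mathsf{Ker}_{\mathcal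 F}(P)$ with respect to it. It admits a vector potential if there are $m\ge 0$ and a $k\times m$ matrix $R$ over $A$ such that $\mathsf{Ker}_{\mathcal F}(P)$ is the image of $R(\partial):\mathcal{F}^m\to\mathcal{F}^k$. **Theorem 2.1.** Suppose that $\mathcal{F}$ is an injective $A$-module. (i) If $A^k/P$ is torsion free, then $\mathsf{Ker}_{\mathcal F}(P)$ admits a vector potential and is controllable. (ii) Suppose moreover that $\mathcal{F}$ is a cogenerator, i.e. $\mathrm{Hom}_A(M,\mathcal{F})\neq 0$ for every nonzero $A$-module $M$, and that every bounded set $V\subset\mathbb{R}^n$ with nonempty interior contains a nonempty subset $U$ whose closure lies in the interior of $V$ and such that the pair $U\subset V$ is admissible with respect to $\mathcal{F}$. Then $\mathsf{Ker}_{\mathcal F}(P)$ is controllable if and only if $A^k/P$ is torsion free. -/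

import Mathlib

open TopologicalSpace
open scoped Distributions LineDeriv

namespace DistSys

/-- The space `𝓓` of (real-valued) test functions on `ℝⁿ`, on which distributions are evaluated. -/
abbrev Test (n : ℕ) : Type :=
  𝓓((⊤ : Opens (EuclideanSpace ℝ (Fin n))), ℝ)

/-- The space `𝓓'` of complex-valued distributions on `ℝⁿ`, a complex vector space. -/
def Dist (n : ℕ) : Type :=
  𝓓'((⊤ : Opens (EuclideanSpace ℝ (Fin n))), ℂ)

noncomputable instance (n : ℕ) : AddCommGroup (Dist n) :=
  inferInstanceAs (AddCommGroup 𝓓'((⊤ : Opens (EuclideanSpace ℝ (Fin n))), ℂ))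

noncomputable instance (n : ℕ) : Module ℂ (Dist n) :=
  inferInstanceAs (Module ℂ 𝓓'((⊤ : Opens (EuclideanSpace ℝ (Fin n))), ℂ))

noncomputable instance (n : ℕ) : FunLike (Dist n) (Test n) ℂ :=
  inferInstanceAs (FunLike 𝓓'((⊤ : Opens (EuclideanSpace ℝ (Fin n))), ℂ) (Test n) ℂ)

noncomputable instance (n : ℕ) : LineDeriv (EuclideanSpace ℝ (Fin n)) (Dist n) (Dist n) :=
  inferInstanceAs (LineDeriv (EuclideanSpace ℝ (Fin n))
    𝓓'((⊤ : Opens (EuclideanSpace ℝ (Fin n))), ℂ) 𝓓'((⊤ : Opens (EuclideanSpace ℝ (Fin n))), ℂ))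

theorem dist_add_apply {n : ℕ} (S T : Dist n) (φ : Test n) : (S + T) φ = S φ + T φ := rfl

theorem dist_smul_apply {n : ℕ} (c : ℂ) (T : Dist n) (φ : Test n) : (c • T) φ = c • T φ := rfl

theorem dist_lineDeriv_apply {n : ℕ} (v : EuclideanSpace ℝ (Fin n)) (T : Dist n) (φ : Test n) :
    (∂_{v} T) φ = -T (∂_{v} φ) := rfl

/-- The ring `A = ℂ[∂₁, …, ∂ₙ]`; the indeterminate `X i` stands for the `i`-th partial derivative. -/
abbrev DiffOps (n : ℕ) : Type := MvPolynomial (Fin n) ℂ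

/-- The `i`-th partial derivative as a `ℂ`-linear endomorphism of `𝓓'`. -/
noncomputable def partialDeriv {n : ℕ} (i : Fin n) : Module.End ℂ (Dist n) where
  toFun T := ∂_{EuclideanSpace.single i (1 : ℝ)} T
  map_add' S T := by
    refine DFunLike.ext _ _ fun φ => ?_
    simp only [dist_lineDeriv_apply, dist_add_apply, neg_add]
  map_smul' c T := by
    refine DFunLike.ext _ _ fun φ => ?_
    simp only [dist_lineDeriv_apply, dist_smul_apply, smul_neg, RingHom.id_apply]

theorem test_lineDeriv_comm {n : ℕ} (v w : EuclideanSpace ℝ (Fin n)) (φ : Test n) :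
    ∂_{v} (∂_{w} φ) = ∂_{w} (∂_{v} φ) := by
  have h1 : ∀ (u : EuclideanSpace ℝ (Fin n)) (ψ : Test n) x,
      (∂_{u} ψ) x = fderiv ℝ ψ x u := by
    intro u ψ x
    rw [TestFunction.lineDerivOp_eq_lineDerivCLM ℝ, TestFunction.lineDerivCLM_eq_fderivCLM,
      TestFunction.fderivCLM_apply_of_le _ (by simp)]
  have hs : ContDiff ℝ (((⊤ : ℕ∞) : WithTop ℕ∞)) φ := φ.contDiff
  have hd : Differentiable ℝ (fderiv ℝ φ) :=
    (hs.fderiv_right (m := 1) (by norm_cast)).differentiable one_ne_zero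
  have h2 : ∀ (u u' : EuclideanSpace ℝ (Fin n)) x,
      (∂_{u} (∂_{u'} φ)) x = fderiv ℝ (fderiv ℝ φ) x u u' := by
    intro u u' x
    rw [h1]
    have : ((∂_{u'} φ : Test n) : EuclideanSpace ℝ (Fin n) → ℝ) = fun y => fderiv ℝ φ y u' := funext (h1 u' φ)
    rw [this, fderiv_clm_apply (hd x) (differentiableAt_const u')]
    simp
  ext x
  rw [h2, h2]
  exact (hs.contDiffAt.isSymmSndFDerivAt (by simp; norm_cast)).eq v w

theorem partialDeriv_comm {n : ℕ} (i j : Fin n) :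
    (partialDeriv i : Module.End ℂ (Dist n)) * partialDeriv j = partialDeriv j * partialDeriv i := by
  refine LinearMap.ext fun T => DFunLike.ext _ _ fun φ => ?_
  change -(-(T _)) = -(-(T _))
  rw [neg_neg, neg_neg]
  exact congrArg T (test_lineDeriv_comm _ _ φ)

/-- The algebra homomorphism `A → End_ℂ(𝓓')` that sends `X i` to the `i`-th partial derivative;
it takes values in the commutative subalgebra generated by the partial derivatives. -/
noncomputable def diffOp (n : ℕ) : DiffOps n →ₐ[ℂ] Module.End ℂ (Dist n) :=
  letI : CommSemiring (Algebra.adjoin ℂ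
      (Set.range (partialDeriv : Fin n → Module.End ℂ (Dist n)))) :=
    { (Algebra.adjoin ℂ
        (Set.range (partialDeriv : Fin n → Module.End ℂ (Dist n)))).toSemiring with
      mul_comm := (Algebra.isMulCommutative_adjoin ℂ (by
        rintro _ ⟨i, rfl⟩ _ ⟨j, rfl⟩
        exact partialDeriv_comm i j)).is_comm.comm }
  (Algebra.adjoin ℂ (Set.range (partialDeriv : Fin n → Module.End ℂ (Dist n)))).val.comp
    (MvPolynomial.aeval fun i => ⟨partialDeriv i, Algebra.subset_adjoin ⟨i, rfl⟩⟩)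

/-- `𝓓'` is an `A`-module: `p • T = p(∂) T`. -/
noncomputable instance distModule (n : ℕ) : Module (DiffOps n) (Dist n) :=
  Module.compHom (Dist n) (diffOp n).toRingHom

theorem X_smul {n : ℕ} (i : Fin n) (T : Dist n) :
    (MvPolynomial.X i : DiffOps n) • T = ∂_{EuclideanSpace.single i (1 : ℝ)} T := by
  change diffOp n (MvPolynomial.X i) T = _
  simp only [diffOp, AlgHom.comp_apply, MvPolynomial.aeval_X]
  rfl

theorem C_smul {n : ℕ} (c : ℂ) (T : Dist n) :
    (MvPolynomial.C c : DiffOps n) • T = c • T := by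
  change diffOp n (algebraMap ℂ (DiffOps n) c) T = _
  rw [AlgHom.commutes]
  rfl

variable {n : ℕ}

/-- The system `Ker_𝓕(P) ⊆ 𝓕ᵏ` defined by a submodule `P ⊆ Aᵏ`: the tuples `f` such that
`p₁(∂) f₁ + ⋯ + pₖ(∂) fₖ = 0` for every `p ∈ P`. -/
noncomputable def ker (F : Submodule (DiffOps n) (Dist n)) {k : ℕ}
    (P : Submodule (DiffOps n) (Fin k → DiffOps n)) : Set (Fin k → F) :=
  {f | ∀ p ∈ P, ∑ j, p j • f j = 0}

/-- The differential operator `R(∂) : 𝓕^m → 𝓕^k` defined by a `k × m` matrix `R` over `A`. -/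
noncomputable def matrixOp (F : Submodule (DiffOps n) (Dist n)) {k m : ℕ}
    (R : Matrix (Fin k) (Fin m) (DiffOps n)) (g : Fin m → F) : Fin k → F :=
  fun i => ∑ j, R i j • g j

/-- A system in `𝓕ᵏ` admits a vector potential if it is the image of some differential operator
`R(∂) : 𝓕^m → 𝓕^k`. -/
def AdmitsVectorPotential (F : Submodule (DiffOps n) (Dist n)) {k : ℕ}
    (B : Set (Fin k → F)) : Prop :=
  ∃ (m : ℕ) (R : Matrix (Fin k) (Fin m) (DiffOps n)), B = Set.range (matrixOp F R)

/-- The distributions `S` and `T` agree on the set `s`: they take the same values on all test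
functions supported in `s`. -/
def AgreeOn (S T : Dist n) (s : Set (EuclideanSpace ℝ (Fin n))) : Prop :=
  ∀ φ : Test n, tsupport φ ⊆ s → S φ = T φ

/-- `Tc` is a cutoff of `T` with respect to `U ⊆ V`: it agrees with `T` on some neighbourhood of `U`
and vanishes on the complement of `V`. -/
def IsCutoff (U V : Set (EuclideanSpace ℝ (Fin n))) (T Tc : Dist n) : Prop :=
  (∃ W, IsOpen W ∧ U ⊆ W ∧ AgreeOn Tc T W) ∧ AgreeOn Tc 0 Vᶜ

/-- The pair `U ⊆ V` is admissible with respect to `𝓕`: every element of `𝓕` has a cutoff in `𝓕`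
with respect to it. -/
def IsAdmissible (F : Submodule (DiffOps n) (Dist n))
    (U V : Set (EuclideanSpace ℝ (Fin n))) : Prop :=
  U ⊆ V ∧ ∀ f : F, ∃ fc : F, IsCutoff U V f fc

/-- A system `B ⊆ 𝓕ᵏ` is controllable: for every pair `U ⊆ V` that is admissible with respect to
`𝓕`, every element of `B` has a cutoff in `B` with respect to it. (Cutoffs of tuples are taken
entry by entry; finitely many neighbourhoods of `U` can be intersected.) -/
def IsControllable (F : Submodule (DiffOps n) (Dist n)) {k : ℕ} (B : Set (Fin k → F)) : Prop :=
  ∀ U V : Set (EuclideanSpace ℝ (Fin n)), IsAdmissible F U V →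
    ∀ f ∈ B, ∃ fc ∈ B, ∀ i, IsCutoff U V (f i) (fc i)

/-- The standing assumption on the signal space: every bounded set `V` with nonempty interior
contains a nonempty set `U`, with closure in the interior of `V`, such that the pair `U ⊆ V` is
admissible with respect to `𝓕`. -/
def HasLocalCutoffs (F : Submodule (DiffOps n) (Dist n)) : Prop :=
  ∀ V : Set (EuclideanSpace ℝ (Fin n)), Bornology.IsBounded V → (interior V).Nonempty →
    ∃ U : Set (EuclideanSpace ℝ (Fin n)),
      U.Nonempty ∧ closure U ⊆ interior V ∧ IsAdmissible F U V

/-- `Hom_A(M, 𝓕)` is nonzero for every nonzero `A`-module `M`. -/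
def IsCogenerator (F : Submodule (DiffOps n) (Dist n)) : Prop :=
  ∀ (M : Type) [AddCommGroup M] [Module (DiffOps n) M], Nontrivial M →
    ∃ φ : M →ₗ[DiffOps n] F, φ ≠ 0

end DistSys

/-! A tuple in `ker F P` is the same as a homomorphism `Aᵏ / P → F`. If `Aᵏ / P` is torsion free, it
embeds in some `Aᵐ` by `x ↦ xR` (`exists_matrix_vecMul_eq_zero_iff`). Injectivity of `F` extends
homomorphisms along this embedding, so the system is the image of `R(∂)`. Images are controllable:
cut off the potential and use that differential operators are local.

Conversely, let `x ∉ P` with `a • x ∈ P` and `a ≠ 0`. By the Nullstellensatz, an injective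
cogenerator contains a solution `f` for which `T = x(∂) f` is a nonzero joint eigenvector of the
`∂ᵢ` (`exists_hom_exponential`). For a cutoff `fc` inside the system, `S = x(∂) fc` has bounded
support and `a(∂) S = 0`; its Fourier transform then forces `S = 0` (`eq_zero_of_smul_eq_zero`). But
`S = T` near a nonempty set, where a nonzero exponential solution cannot vanish
(`eq_zero_of_agreeOn_zero`).

All analysis goes through the scalar functions `y ↦ T (translate y φ)`, whose derivatives come from
the derivatives of `T`. -/

open MeasureTheory FourierTransform Filter Topology

namespace DistSys

/-! ### Uniform Taylor estimates for compactly supported smooth functions -/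

section Calculus

universe u

-- A common universe lets the induction on the order replace `G` by `E →L[ℝ] G`.
variable {E G : Type u} [NormedAddCommGroup E] [NormedSpace ℝ E]
  [NormedAddCommGroup G] [NormedSpace ℝ G]

/-- The first-order Taylor expansion of a compactly supported smooth function is uniform in the
base point. -/
theorem exists_norm_taylor_le {f : E → G} (hf : ContDiff ℝ 1 f) (hc : HasCompactSupport f)
    {ε : ℝ} (hε : 0 < ε) :
    ∃ δ > 0, ∀ h : E, ‖h‖ < δ → ∀ x, ‖f (x - h) - f x + fderiv ℝ f x h‖ ≤ ε * ‖h‖ := by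
  have hu : UniformContinuous (fderiv ℝ f) :=
    (hc.fderiv (𝕜 := ℝ)).uniformContinuous_of_continuous (hf.continuous_fderiv one_ne_zero)
  obtain ⟨δ, hδ, H⟩ := Metric.uniformContinuous_iff.1 hu ε hε
  refine ⟨δ, hδ, fun h hh x => ?_⟩
  have key := (convex_ball x δ).norm_image_sub_le_of_norm_fderiv_le' (𝕜 := ℝ) (f := f)
    (φ := fderiv ℝ f x) (C := ε) (x := x) (y := x - h)
    (fun y _ => (hf.differentiable one_ne_zero) y)
    (fun y hy => by rw [← dist_eq_norm]; exact (H hy).le)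
    (Metric.mem_ball_self hδ) (by simpa [dist_eq_norm] using hh)
  simpa using key

/-- By symmetry of the second derivative, differentiating the remainder of `f` gives the remainder
of `fderiv ℝ f`; this drives the induction below. -/
theorem fderiv_taylor_remainder {f : E → G} (hf : ContDiff ℝ (⊤ : ℕ∞) f) (h : E) :
    fderiv ℝ (fun x => f (x - h) - f x + fderiv ℝ f x h) =
      fun x => fderiv ℝ f (x - h) - fderiv ℝ f x + fderiv ℝ (fderiv ℝ f) x h := by
  have hd : Differentiable ℝ f := hf.differentiable (by norm_num)
  have hd' : Differentiable ℝ (fderiv ℝ f) :=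
    (hf.fderiv_right (m := 1) (by norm_cast)).differentiable one_ne_zero
  funext x
  have h1 : HasFDerivAt (fun x => f (x - h)) (fderiv ℝ f (x - h)) x := by
    have := (hd (x - h)).hasFDerivAt.comp x ((hasFDerivAt_id x).sub_const h)
    rwa [ContinuousLinearMap.comp_id] at this
  have h2 : HasFDerivAt (fun x => fderiv ℝ f x h) ((fderiv ℝ (fderiv ℝ f) x).flip h) x := by
    simpa using (hd' x).hasFDerivAt.clm_apply (hasFDerivAt_const h x)
  refine ((h1.sub (hd x).hasFDerivAt).add h2).fderiv.trans ?_
  congr 1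
  ext v
  exact (hf.contDiffAt.isSymmSndFDerivAt (by simp; norm_cast)).eq v h

theorem exists_norm_iteratedFDeriv_taylor_le (i : ℕ) {f : E → G}
    (hf : ContDiff ℝ (⊤ : ℕ∞) f) (hc : HasCompactSupport f) {ε : ℝ} (hε : 0 < ε) :
    ∃ δ > 0, ∀ h : E, ‖h‖ < δ → ∀ x,
      ‖iteratedFDeriv ℝ i (fun x => f (x - h) - f x + fderiv ℝ f x h) x‖ ≤ ε * ‖h‖ := by
  induction i generalizing G with
  | zero =>
    simpa using exists_norm_taylor_le (hf.of_le (by norm_cast)) hc hε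
  | succ i ih =>
    obtain ⟨δ, hδ, H⟩ := ih (f := fderiv ℝ f)
      (hf.fderiv_right (m := ((⊤ : ℕ∞) : WithTop ℕ∞)) (by norm_cast)) (hc.fderiv (𝕜 := ℝ))
    refine ⟨δ, hδ, fun h hh x => ?_⟩
    rw [← norm_iteratedFDeriv_fderiv, fderiv_taylor_remainder hf]
    exact H h hh x

end Calculus

/-! ### Translates of test functions and differentiability of `y ↦ T (translate y φ)` -/

variable {n : ℕ}

theorem test_lineDeriv_apply (v : EuclideanSpace ℝ (Fin n)) (φ : Test n)
    (x : EuclideanSpace ℝ (Fin n)) : (∂_{v} φ : Test n) x = fderiv ℝ φ x v := by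
  rw [TestFunction.lineDerivOp_eq_lineDerivCLM ℝ, TestFunction.lineDerivCLM_eq_fderivCLM,
    TestFunction.fderivCLM_apply_of_le _ (by simp)]

theorem tsupport_test_lineDeriv_subset (v : EuclideanSpace ℝ (Fin n)) (φ : Test n) :
    tsupport (∂_{v} φ : Test n) ⊆ tsupport φ := by
  have : ((∂_{v} φ : Test n) : EuclideanSpace ℝ (Fin n) → ℝ) = fun x => fderiv ℝ φ x v :=
    funext (test_lineDeriv_apply v φ)
  rw [this]
  exact tsupport_fderiv_apply_subset ℝ v

/-- The test function `x ↦ φ (x - v)`. -/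
noncomputable def translate (v : EuclideanSpace ℝ (Fin n)) (φ : Test n) : Test n where
  toFun x := φ (x - v)
  contDiff' := φ.contDiff.comp (contDiff_id.sub contDiff_const)
  hasCompactSupport' := φ.hasCompactSupport.comp_homeomorph (Homeomorph.subRight v)
  tsupport_subset' := by simp

@[simp]
theorem translate_apply (v : EuclideanSpace ℝ (Fin n)) (φ : Test n)
    (x : EuclideanSpace ℝ (Fin n)) : translate v φ x = φ (x - v) := rfl

@[simp]
theorem translate_zero (φ : Test n) : translate 0 φ = φ := by
  ext x; simp

theorem translate_translate (v w : EuclideanSpace ℝ (Fin n)) (φ : Test n) :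
    translate v (translate w φ) = translate (w + v) φ := by
  ext x
  simp only [translate_apply]
  congr 1
  abel

theorem tsupport_translate (v : EuclideanSpace ℝ (Fin n)) (φ : Test n) :
    tsupport (translate v φ) = (fun x => x - v) ⁻¹' tsupport φ :=
  tsupport_comp_eq_preimage φ (Homeomorph.subRight v)

theorem dist_map_add (T : Dist n) (φ ψ : Test n) : T (φ + ψ) = T φ + T ψ :=
  ContinuousLinearMap.map_add
    (show 𝓓'((⊤ : Opens (EuclideanSpace ℝ (Fin n))), ℂ) from T) φ ψ

theorem dist_map_smul (T : Dist n) (c : ℝ) (φ : Test n) : T (c • φ) = c • T φ :=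
  ContinuousLinearMap.map_smul
    (show 𝓓'((⊤ : Opens (EuclideanSpace ℝ (Fin n))), ℂ) from T) c φ

theorem dist_continuous (T : Dist n) : Continuous (T : Test n → ℂ) :=
  ContinuousLinearMap.continuous
    (show 𝓓'((⊤ : Opens (EuclideanSpace ℝ (Fin n))), ℂ) from T)

/-- A distribution as a real linear map on test functions. -/
noncomputable def distLinear (T : Dist n) : Test n →ₗ[ℝ] ℂ where
  toFun := T
  map_add' := dist_map_add T
  map_smul' := dist_map_smul T

@[simp]
theorem distLinear_apply (T : Dist n) (φ : Test n) : distLinear T φ = T φ := rfl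

/-- A distribution is of finite order on test functions supported in a fixed compact set. -/
theorem exists_dist_bound (T : Dist n) (K : Compacts (EuclideanSpace ℝ (Fin n))) :
    ∃ (N : Finset ℕ) (C : ℝ), 0 ≤ C ∧ ∀ (φ : Test n) (M : ℝ), 0 ≤ M → tsupport φ ⊆ K →
      (∀ i ∈ N, ∀ x, ‖iteratedFDeriv ℝ i φ x‖ ≤ M) → ‖T φ‖ ≤ C * M := by
  have hK : (K : Set (EuclideanSpace ℝ (Fin n))) ⊆
      (⊤ : Opens (EuclideanSpace ℝ (Fin n))) := by simp
  let L : 𝓓_{K}(EuclideanSpace ℝ (Fin n), ℝ) →ₗ[ℝ] ℂ :=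
    distLinear T ∘ₗ (TestFunction.ofSupportedInCLM ℝ hK).toLinearMap
  have hL : Continuous L :=
    (dist_continuous T).comp (TestFunction.ofSupportedInCLM ℝ hK).continuous
  obtain ⟨N, C, -, hC⟩ := Seminorm.bound_of_continuous
    (ContDiffMapSupportedIn.withSeminorms ℝ (EuclideanSpace ℝ (Fin n)) ℝ ⊤ K)
    ((normSeminorm ℝ ℂ).comp L) (continuous_norm.comp hL)
  refine ⟨N, C, C.2, fun φ M hM hφ H => ?_⟩
  let ψ : 𝓓_{K}(EuclideanSpace ℝ (Fin n), ℝ) :=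
    .of_support_subset φ.contDiff ((subset_tsupport _).trans hφ)
  have h1 := hC ψ
  have h2 : L ψ = T φ := rfl
  have h3 : (N.sup (ContDiffMapSupportedIn.seminorm ℝ (EuclideanSpace ℝ (Fin n)) ℝ ⊤ K)) ψ
      ≤ M := by
    refine Seminorm.finset_sup_apply_le hM fun i hi => ?_
    rw [ContDiffMapSupportedIn.seminorm_top_le_iff ℝ hM]
    exact fun x _ => H i hi x
  calc ‖T φ‖ ≤ C * (N.sup (ContDiffMapSupportedIn.seminorm ℝ
        (EuclideanSpace ℝ (Fin n)) ℝ ⊤ K)) ψ := h1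
    _ ≤ C * M := by gcongr

/-- The linear map `v ↦ -T (∂_v φ)`. -/
noncomputable def negDerivCLM (T : Dist n) (φ : Test n) :
    EuclideanSpace ℝ (Fin n) →L[ℝ] ℂ :=
  LinearMap.toContinuousLinearMap
    { toFun v := -T (∂_{v} φ)
      map_add' v w := by
        have : (∂_{v + w} φ : Test n) = ∂_{v} φ + ∂_{w} φ := by
          ext x
          change _ = (∂_{v} φ : Test n) x + (∂_{w} φ : Test n) x
          simp only [test_lineDeriv_apply, map_add]
        rw [this, dist_map_add, neg_add]
      map_smul' c v := by
        have : (∂_{c • v} φ : Test n) = c • ∂_{v} φ := by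
          ext x
          change _ = c • (∂_{v} φ : Test n) x
          simp only [test_lineDeriv_apply, map_smul]
        rw [this, dist_map_smul, smul_neg, RingHom.id_apply] }

@[simp]
theorem negDerivCLM_apply (T : Dist n) (φ : Test n) (v : EuclideanSpace ℝ (Fin n)) :
    negDerivCLM T φ v = -T (∂_{v} φ) := rfl

/-- For small `h`, the Taylor remainders of `φ` are supported in one compact set, where `T` has
finite order; the uniform Taylor estimates then make `T` of the remainder `o(‖h‖)`. -/
theorem hasFDerivAt_translate_zero (T : Dist n) (φ : Test n) :
    HasFDerivAt (fun y => T (translate y φ)) (negDerivCLM T φ) 0 := by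
  let K : Compacts (EuclideanSpace ℝ (Fin n)) :=
    ⟨Metric.cthickening 1 (tsupport φ), φ.hasCompactSupport.isCompact.cthickening⟩
  obtain ⟨N, C, hC, hT⟩ := exists_dist_bound T K
  rw [hasFDerivAt_iff_isLittleO_nhds_zero, Asymptotics.isLittleO_iff]
  intro c hc
  -- `C` may be zero, hence the division by `C + 1`.
  have hε : 0 < c / (C + 1) := by positivity
  have hev : ∀ᶠ h : EuclideanSpace ℝ (Fin n) in 𝓝 0, ∀ i ∈ N, ∀ x,
      ‖iteratedFDeriv ℝ i (fun x => φ (x - h) - φ x + fderiv ℝ φ x h) x‖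
        ≤ c / (C + 1) * ‖h‖ := by
    rw [Filter.eventually_all_finset]
    intro i _
    obtain ⟨δ, hδ, H⟩ := exists_norm_iteratedFDeriv_taylor_le i φ.contDiff
      φ.hasCompactSupport hε
    filter_upwards [Metric.ball_mem_nhds (0 : EuclideanSpace ℝ (Fin n)) hδ] with h hh
    exact H h (by simpa using hh)
  filter_upwards [hev, Metric.ball_mem_nhds (0 : EuclideanSpace ℝ (Fin n)) one_pos] with h hh h1
  have h1' : ‖h‖ < 1 := by simpa using h1
  let ψ : Test n := translate h φ - φ + ∂_{h} φ
  have hψ : (ψ : EuclideanSpace ℝ (Fin n) → ℝ) =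
      fun x => φ (x - h) - φ x + fderiv ℝ φ x h := by
    funext x
    rw [← test_lineDeriv_apply]
    rfl
  have hTψ : T (translate (0 + h) φ) - T (translate 0 φ) - negDerivCLM T φ h = T ψ := by
    rw [zero_add, translate_zero, negDerivCLM_apply, sub_neg_eq_add]
    simp only [← distLinear_apply, ψ, map_add, map_sub]
  have hsub : tsupport φ ⊆ K := Metric.self_subset_cthickening _
  have hsupp : tsupport ψ ⊆ K := by
    refine (tsupport_add _ _).trans (Set.union_subset ((tsupport_sub _ _).trans
      (Set.union_subset ?_ hsub)) ((tsupport_test_lineDeriv_subset h φ).trans hsub))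
    rw [tsupport_translate]
    intro x hx
    refine Metric.mem_cthickening_of_dist_le x (x - h) 1 _ hx ?_
    simpa [dist_eq_norm] using h1'.le
  rw [hTψ]
  calc ‖T ψ‖ ≤ C * (c / (C + 1) * ‖h‖) :=
        hT ψ _ (by positivity) hsupp fun i hi x => by rw [hψ]; exact hh i hi x
    _ = c * ‖h‖ * (C / (C + 1)) := by ring
    _ ≤ c * ‖h‖ * 1 := by
        gcongr
        rw [div_le_one (by positivity)]
        linarith
    _ = c * ‖h‖ := mul_one _

theorem hasFDerivAt_translate (T : Dist n) (φ : Test n) (y : EuclideanSpace ℝ (Fin n)) :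
    HasFDerivAt (fun y => T (translate y φ)) (negDerivCLM T (translate y φ)) y := by
  have h := hasFDerivAt_translate_zero T (translate y φ)
  simp only [translate_translate] at h
  have h' : HasFDerivAt (fun z => T (translate (y + z) φ))
      (negDerivCLM T (translate y φ)) (y - y) := by simpa using h
  simpa [Function.comp_def] using
    HasFDerivAt.comp (f := fun z => z - y) y h' ((hasFDerivAt_id y).sub_const y)

/-! ### Embedding a torsion free quotient in a free module -/

section Algebra

variable {A : Type*} [CommRing A] [IsDomain A] {k : ℕ}

/-- If `Aᵏ / P` is torsion free, then every vector outside `P` is separated from `P` by a vector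
orthogonal to `P`. -/
theorem exists_orthogonal_of_notMem (P : Submodule A (Fin k → A))
    (hP : Module.IsTorsionFree A ((Fin k → A) ⧸ P)) {x : Fin k → A} (hx : x ∉ P) :
    ∃ r : Fin k → A, (∀ p ∈ P, p ⬝ᵥ r = 0) ∧ x ⬝ᵥ r ≠ 0 := by
  let K := FractionRing A
  let ι : (Fin k → A) →ₗ[A] (Fin k → K) := (Algebra.linearMap A K).compLeft (Fin k)
  have hι : ∀ p i, ι p i = algebraMap A K (p i) := fun _ _ => rfl
  have hinj : Function.Injective (algebraMap A K) := IsFractionRing.injective A K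
  have hιinj : Function.Injective ι := fun p q h => funext fun i => hinj (congrFun h i)
  let W : Submodule K (Fin k → K) := Submodule.span K (ι '' P)
  -- Clearing denominators: every vector of the `K`-span has a nonzero `A`-multiple in `P`. Torsion
  -- freeness then keeps `x` out of the span.
  have hW : ∀ y ∈ W, ∃ a : A, a ≠ 0 ∧ ∃ p ∈ P, a • y = ι p := by
    intro y hy
    induction hy using Submodule.span_induction with
    | mem y hy =>
      obtain ⟨p, hp, rfl⟩ := hy
      exact ⟨1, one_ne_zero, p, hp, one_smul _ _⟩
    | zero => exact ⟨1, one_ne_zero, 0, P.zero_mem, by simp⟩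
    | add y z _ _ hy hz =>
      obtain ⟨a, ha, p, hp, hap⟩ := hy
      obtain ⟨b, hb, q, hq, hbq⟩ := hz
      refine ⟨a * b, mul_ne_zero ha hb, b • p + a • q,
        P.add_mem (P.smul_mem _ hp) (P.smul_mem _ hq), ?_⟩
      rw [map_add, map_smul, map_smul, ← hap, ← hbq, smul_add, smul_smul, smul_smul, mul_comm b a]
    | smul c y _ hy =>
      obtain ⟨a, ha, p, hp, hap⟩ := hy
      obtain ⟨s, t, ht, rfl⟩ := IsFractionRing.div_surjective (A := A) c
      have ht0 : t ≠ 0 := nonZeroDivisors.ne_zero ht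
      have ht' : algebraMap A K t ≠ 0 := fun h => ht0 (hinj (by simpa using h))
      refine ⟨t * a, mul_ne_zero ht0 ha, s • p, P.smul_mem _ hp, ?_⟩
      rw [map_smul, ← hap]
      ext i
      simp only [Pi.smul_apply, smul_eq_mul]
      rw [Algebra.smul_def, Algebra.smul_def, Algebra.smul_def, map_mul]
      have e : algebraMap A K t * (algebraMap A K s / algebraMap A K t) = algebraMap A K s :=
        mul_div_cancel₀ _ ht'
      linear_combination (algebraMap A K a * y i) * e
  have hxW : ι x ∉ W := by
    intro h
    obtain ⟨a, ha, p, hp, hap⟩ := hW _ h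
    rw [← map_smul] at hap
    have h1 : a • x = p := hιinj hap
    have h2 : a • (Submodule.Quotient.mk x : (Fin k → A) ⧸ P) = 0 := by
      rw [← Submodule.Quotient.mk_smul, Submodule.Quotient.mk_eq_zero, h1]
      exact hp
    rcases Module.isTorsionFree_iff_smul_eq_zero.1 hP a _ h2 with h3 | h3
    · exact ha h3
    · exact hx ((Submodule.Quotient.mk_eq_zero P).1 h3)
  obtain ⟨f, hf, hker⟩ := Submodule.exists_le_ker_of_notMem hxW
  have hfsum : ∀ y : Fin k → K, f y = ∑ i, y i * f (Pi.single i 1) := by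
    intro y
    conv_lhs => rw [pi_eq_sum_univ' y]
    simp [map_sum]
  -- A common denominator `b` turns the separating functional `f` into a vector `r` over `A`.
  obtain ⟨b, hb⟩ := IsLocalization.exist_integer_multiples_of_finite (nonZeroDivisors A)
    (fun i : Fin k => f (Pi.single i 1))
  choose r hr using hb
  have hb0 : algebraMap A K (b : A) ≠ 0 :=
    fun h => nonZeroDivisors.ne_zero b.2 (hinj (h.trans (map_zero _).symm))
  have key : ∀ p : Fin k → A, algebraMap A K (p ⬝ᵥ r) = algebraMap A K b * f (ι p) := by
    intro p
    rw [hfsum, dotProduct, map_sum, Finset.mul_sum]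
    refine Finset.sum_congr rfl fun i _ => ?_
    rw [map_mul, hr, Algebra.smul_def, hι]
    ring
  refine ⟨r, fun p hp => hinj ?_, fun h => ?_⟩
  · rw [key, map_zero, LinearMap.mem_ker.1 (hker (Submodule.subset_span ⟨p, hp, rfl⟩)), mul_zero]
  · have := key x
    rw [h, map_zero] at this
    exact mul_ne_zero hb0 hf this.symm

/-- A submodule `P ⊆ Aᵏ` with torsion free quotient, over a Noetherian domain, is the kernel of
a matrix. -/
theorem exists_matrix_vecMul_eq_zero_iff [IsNoetherianRing A] (P : Submodule A (Fin k → A))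
    (hP : Module.IsTorsionFree A ((Fin k → A) ⧸ P)) :
    ∃ (m : ℕ) (R : Matrix (Fin k) (Fin m) A), ∀ x, Matrix.vecMul x R = 0 ↔ x ∈ P := by
  let Q : Submodule A (Fin k → A) :=
    { carrier := {r | ∀ p ∈ P, p ⬝ᵥ r = 0}
      add_mem' := fun ha hb p hp => by rw [dotProduct_add, ha p hp, hb p hp, add_zero]
      zero_mem' := fun p _ => dotProduct_zero p
      smul_mem' := fun c r hr p hp => by rw [dotProduct_smul, hr p hp, smul_zero] }
  obtain ⟨m, s, hs⟩ := Submodule.fg_iff_exists_fin_generating_family.1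
    (IsNoetherian.noetherian Q)
  -- The columns of `R` generate the orthogonal complement `Q` of `P`.
  refine ⟨m, fun i j => s j i, fun x => ⟨fun h => ?_, fun h => ?_⟩⟩
  · by_contra hx
    obtain ⟨r, hr, hxr⟩ := exists_orthogonal_of_notMem P hP hx
    have hrQ : r ∈ Submodule.span A (Set.range s) := hs ▸ (show r ∈ Q from hr)
    clear hr
    refine hxr ?_
    clear hxr
    induction hrQ using Submodule.span_induction with
    | mem y hy =>
      obtain ⟨j, rfl⟩ := hy
      exact congrFun h j
    | zero => simp
    | add y z _ _ hy hz => rw [dotProduct_add, hy, hz, add_zero]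
    | smul c y _ hy => rw [dotProduct_smul, hy, smul_zero]
  · funext j
    have : s j ∈ Q := hs ▸ Submodule.subset_span ⟨j, rfl⟩
    exact this x h

end Algebra

/-! ### Systems as homomorphism spaces, and vector potentials -/

variable {k : ℕ}

theorem sum_smul_single {A : Type*} [CommRing A] (x : Fin k → A) :
    ∑ j, x j • (Pi.single j 1 : Fin k → A) = x := by
  rw [← pi_eq_sum_univ' x]

/-- An element `f` of `Ker_𝓕(P)` is a homomorphism `Aᵏ / P → 𝓕`. -/
noncomputable def kerHom (F : Submodule (DiffOps n) (Dist n))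
    (P : Submodule (DiffOps n) (Fin k → DiffOps n)) {f : Fin k → F} (hf : f ∈ ker F P) :
    ((Fin k → DiffOps n) ⧸ P) →ₗ[DiffOps n] F :=
  P.liftQ (Fintype.linearCombination (DiffOps n) f) fun p hp => hf p hp

theorem kerHom_mk (F : Submodule (DiffOps n) (Dist n))
    (P : Submodule (DiffOps n) (Fin k → DiffOps n)) {f : Fin k → F} (hf : f ∈ ker F P)
    (x : Fin k → DiffOps n) : kerHom F P hf (Submodule.Quotient.mk x) = ∑ j, x j • f j := rfl

theorem hom_mk_eq_sum (F : Submodule (DiffOps n) (Dist n))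
    (P : Submodule (DiffOps n) (Fin k → DiffOps n))
    (ψ : ((Fin k → DiffOps n) ⧸ P) →ₗ[DiffOps n] F) (x : Fin k → DiffOps n) :
    ψ (Submodule.Quotient.mk x) =
      ∑ j, x j • ψ (Submodule.Quotient.mk (Pi.single j 1)) := by
  conv_lhs => rw [← sum_smul_single x]
  change ψ (P.mkQ _) = ∑ j, x j • ψ (P.mkQ _)
  simp only [map_sum, map_smul]

theorem ker_eq_range_matrixOp (F : Submodule (DiffOps n) (Dist n))
    (hF : Module.Injective (DiffOps n) F) (P : Submodule (DiffOps n) (Fin k → DiffOps n))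
    {m : ℕ} (R : Matrix (Fin k) (Fin m) (DiffOps n))
    (hR : ∀ x, Matrix.vecMul x R = 0 ↔ x ∈ P) : ker F P = Set.range (matrixOp F R) := by
  ext f
  constructor
  · intro hf
    let ι : ((Fin k → DiffOps n) ⧸ P) →ₗ[DiffOps n] (Fin m → DiffOps n) :=
      P.liftQ R.vecMulLinear fun p hp => (hR p).2 hp
    have hι : Function.Injective ι := by
      rw [← LinearMap.ker_eq_bot]
      exact Submodule.ker_liftQ_eq_bot _ _ _ fun x hx => (hR x).1 hx
    obtain ⟨h, hh⟩ := hF.out ι hι (kerHom F P hf)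
    refine ⟨fun j => h (Pi.single j 1), ?_⟩
    funext i
    have h1 := hh (Submodule.Quotient.mk (Pi.single i 1))
    rw [kerHom_mk, Finset.sum_eq_single i (by intro j _ hj; simp [hj]) (by simp)] at h1
    have h2 : ι (Submodule.Quotient.mk (Pi.single i 1)) = R i := by
      change Matrix.vecMul (Pi.single i 1) R = R i
      exact Matrix.single_one_vecMul i R
    rw [h2, Pi.single_eq_same, one_smul] at h1
    rw [← h1]
    conv_rhs => rw [← sum_smul_single (R i)]
    simp [matrixOp]
  · rintro ⟨g, rfl⟩ p hp
    have h1 : ∀ j, ∑ i, p i * R i j = 0 := fun j => congrFun ((hR p).2 hp) j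
    simp only [matrixOp, Finset.smul_sum, smul_smul]
    rw [Finset.sum_comm]
    simp only [← Finset.sum_smul, h1, zero_smul, Finset.sum_const_zero]

/-! ### Locality of differential operators and controllability of images -/

theorem AgreeOn.mono {S T : Dist n} {s t : Set (EuclideanSpace ℝ (Fin n))} (h : AgreeOn S T t)
    (hst : s ⊆ t) : AgreeOn S T s := fun φ hφ => h φ (hφ.trans hst)

/-- Constant coefficient differential operators are local. -/
theorem AgreeOn.smul {S T : Dist n} {s : Set (EuclideanSpace ℝ (Fin n))} (h : AgreeOn S T s)
    (p : DiffOps n) : AgreeOn (p • S) (p • T) s := by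
  induction p using MvPolynomial.induction_on with
  | C c =>
    intro φ hφ
    rw [C_smul, C_smul, dist_smul_apply, dist_smul_apply, h φ hφ]
  | add p q hp hq =>
    intro φ hφ
    rw [add_smul, add_smul, dist_add_apply, dist_add_apply, hp φ hφ, hq φ hφ]
  | mul_X p i hp =>
    intro φ hφ
    rw [mul_comm, mul_smul, mul_smul, X_smul, X_smul, dist_lineDeriv_apply, dist_lineDeriv_apply,
      hp _ ((tsupport_test_lineDeriv_subset _ φ).trans hφ)]

theorem AgreeOn.sum {ι : Type*} (J : Finset ι) {S T : ι → Dist n}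
    {s : Set (EuclideanSpace ℝ (Fin n))} (h : ∀ j ∈ J, AgreeOn (S j) (T j) s) :
    AgreeOn (∑ j ∈ J, S j) (∑ j ∈ J, T j) s := by
  induction J using Finset.cons_induction with
  | empty => exact fun φ _ => rfl
  | cons a J ha ih =>
    intro φ hφ
    rw [Finset.sum_cons, Finset.sum_cons, dist_add_apply, dist_add_apply,
      h a (Finset.mem_cons_self a J) φ hφ, ih (fun j hj => h j (Finset.mem_cons_of_mem hj)) φ hφ]

/-- Applying a row of differential operators to a tuple of cutoffs gives a cutoff. -/
theorem IsCutoff.sum_smul {U V : Set (EuclideanSpace ℝ (Fin n))} {ι : Type*} [Fintype ι]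
    {T Tc : ι → Dist n} (h : ∀ j, IsCutoff U V (T j) (Tc j)) (x : ι → DiffOps n) :
    IsCutoff U V (∑ j, x j • T j) (∑ j, x j • Tc j) := by
  choose W hWo hUW hW using fun j => (h j).1
  refine ⟨⟨⋂ j, W j, isOpen_iInter_of_finite hWo, Set.subset_iInter hUW, ?_⟩, ?_⟩
  · exact AgreeOn.sum _ fun j _ => ((hW j).smul (x j)).mono (Set.iInter_subset W j)
  · have := AgreeOn.sum Finset.univ fun j _ => ((h j).2.smul (x j))
    simpa using this

theorem isControllable_range_matrixOp (F : Submodule (DiffOps n) (Dist n)) {m : ℕ}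
    (R : Matrix (Fin k) (Fin m) (DiffOps n)) : IsControllable F (Set.range (matrixOp F R)) := by
  rintro U V ⟨-, hUV⟩ _ ⟨g, rfl⟩
  choose c hc using hUV
  refine ⟨matrixOp F R fun j => c (g j), ⟨_, rfl⟩, fun i => ?_⟩
  have := IsCutoff.sum_smul (fun j => hc (g j)) (R i)
  simpa [matrixOp] using this

/-! ### Fourier analysis of distributions with bounded support -/

/-- The integral transform `ξ ↦ ∫ T(φ(· - y)) e^{-2πi⟨y, ξ⟩} dy` of a distribution. -/
noncomputable def fourierTranslate (φ : Test n) (T : Dist n) :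
    EuclideanSpace ℝ (Fin n) → ℂ := 𝓕 fun y => T (translate y φ)

theorem continuous_apply_translate (T : Dist n) (φ : Test n) :
    Continuous fun y => T (translate y φ) :=
  continuous_iff_continuousAt.2 fun y => (hasFDerivAt_translate T φ y).continuousAt

/-- Once `‖y‖` exceeds the sum of the radii of `V` and of the support of `φ`, the translated support
misses `V`. -/
theorem hasCompactSupport_apply_translate {V : Set (EuclideanSpace ℝ (Fin n))}
    (hV : Bornology.IsBounded V) {T : Dist n} (hT : AgreeOn T 0 Vᶜ) (φ : Test n) :
    HasCompactSupport fun y => T (translate y φ) := by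
  obtain ⟨a, ha⟩ := hV.exists_norm_le
  obtain ⟨b, hb⟩ := φ.hasCompactSupport.isCompact.isBounded.exists_norm_le
  refine HasCompactSupport.of_support_subset_isCompact
    (isCompact_closedBall (0 : EuclideanSpace ℝ (Fin n)) (a + b)) fun y hy => ?_
  by_contra hy'
  refine hy (hT _ fun x hx hxV => hy' ?_)
  rw [tsupport_translate] at hx
  rw [mem_closedBall_zero_iff]
  calc ‖y‖ = ‖x - (x - y)‖ := by rw [sub_sub_cancel]
    _ ≤ ‖x‖ + ‖x - y‖ := norm_sub_le _ _
    _ ≤ a + b := add_le_add (ha x hxV) (hb _ hx)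

theorem fourierTranslate_lineDeriv {V : Set (EuclideanSpace ℝ (Fin n))}
    (hV : Bornology.IsBounded V) {T : Dist n} (hT : AgreeOn T 0 Vᶜ) (φ : Test n)
    (v ξ : EuclideanSpace ℝ (Fin n)) :
    fourierTranslate φ (∂_{v} T) ξ =
      2 * Real.pi * Complex.I * (inner ℝ v ξ : ℝ) * fourierTranslate φ T ξ := by
  let g : EuclideanSpace ℝ (Fin n) → ℂ := fun y => T (translate y φ)
  have hg : HasCompactSupport g := hasCompactSupport_apply_translate hV hT φ
  have hderiv : ∀ w y, fderiv ℝ g y w = (∂_{w} T) (translate y φ) := fun w y => by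
    rw [(hasFDerivAt_translate T φ y).fderiv]
    rfl
  have hc : Continuous (fderiv ℝ g) := by
    rw [continuous_clm_apply]
    intro w
    simp only [hderiv]
    exact continuous_apply_translate _ φ
  have hi : Integrable (fderiv ℝ g) := hc.integrable_of_hasCompactSupport (hg.fderiv (𝕜 := ℝ))
  have hF := Real.fourier_fderiv (f := g)
    ((continuous_apply_translate T φ).integrable_of_hasCompactSupport hg)
    (fun y => (hasFDerivAt_translate T φ y).differentiableAt) hi
  have h1 : fourierTranslate φ (∂_{v} T) ξ = 𝓕 (fderiv ℝ g) ξ v := by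
    rw [Real.fourier_continuousLinearMap_apply hi]
    simp only [hderiv]
    rfl
  rw [h1, hF]
  simp only [VectorFourier.fourierSMulRight_apply]
  have h2 : innerSL ℝ ξ v = inner ℝ v ξ := by rw [innerSL_apply_apply, real_inner_comm]
  simp [fourierTranslate, g, h2]
  ring

theorem fourierTranslate_smul {V : Set (EuclideanSpace ℝ (Fin n))}
    (hV : Bornology.IsBounded V) {T : Dist n} (hT : AgreeOn T 0 Vᶜ) (φ : Test n)
    (p : DiffOps n) (ξ : EuclideanSpace ℝ (Fin n)) :
    fourierTranslate φ (p • T) ξ =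
      MvPolynomial.eval (fun i => 2 * Real.pi * Complex.I * (ξ i : ℂ)) p *
        fourierTranslate φ T ξ := by
  have hsupp : ∀ q : DiffOps n, AgreeOn (q • T) 0 Vᶜ := fun q => by simpa using hT.smul q
  have hint : ∀ q : DiffOps n, Integrable fun y => (q • T) (translate y φ) := fun q =>
    (continuous_apply_translate _ φ).integrable_of_hasCompactSupport
      (hasCompactSupport_apply_translate hV (hsupp q) φ)
  induction p using MvPolynomial.induction_on with
  | C c =>
    rw [C_smul, MvPolynomial.eval_C]
    simp only [fourierTranslate, dist_smul_apply, Real.fourier_eq]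
    rw [← smul_eq_mul, ← integral_smul]
    simp only [smul_comm c]
  | add p q hp hq =>
    rw [map_add, add_mul, ← hp, ← hq]
    rw [add_smul]
    exact congrFun (VectorFourier.fourierIntegral_add Real.continuous_fourierChar
      (by exact continuous_inner) (hint p) (hint q)) ξ
  | mul_X p i hp =>
    rw [mul_comm p, mul_smul, X_smul, fourierTranslate_lineDeriv hV (hsupp p), hp, map_mul,
      MvPolynomial.eval_X]
    simp [EuclideanSpace.inner_single_left, mul_assoc]

/-- A polynomial vanishing at all purely imaginary points near a given one is zero. -/
theorem eq_zero_of_eventually_eval_eq_zero (a : DiffOps n) (ξ₀ : EuclideanSpace ℝ (Fin n))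
    (h : ∀ᶠ ξ : EuclideanSpace ℝ (Fin n) in 𝓝 ξ₀,
      MvPolynomial.eval (fun i => 2 * Real.pi * Complex.I * (ξ i : ℂ)) a = 0) : a = 0 := by
  have h' : ∀ᶠ y in 𝓝 (WithLp.ofLp ξ₀), MvPolynomial.eval
      (fun i => 2 * Real.pi * Complex.I * ((y i : ℝ) : ℂ)) a = 0 :=
    ((PiLp.continuous_toLp 2 fun _ : Fin n => ℝ).tendsto (WithLp.ofLp ξ₀)).eventually h
  obtain ⟨ε, hε, H⟩ := Metric.eventually_nhds_iff_ball.1 h'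
  have hinj : Function.Injective fun t : ℝ => 2 * Real.pi * Complex.I * (t : ℂ) := by
    intro s t hst
    have : (2 * Real.pi * Complex.I : ℂ) ≠ 0 := Complex.two_pi_I_ne_zero
    exact_mod_cast mul_left_cancel₀ this hst
  refine MvPolynomial.funext_set
    (fun i => (fun t : ℝ => 2 * Real.pi * Complex.I * (t : ℂ)) '' Metric.ball (ξ₀ i) ε)
    (fun i => Set.Infinite.image hinj.injOn (infinite_of_mem_nhds _ (Metric.ball_mem_nhds _ hε)))
    fun x hx => ?_
  choose y hy hyx using fun i => hx i (Set.mem_univ i)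
  have hy' : y ∈ Metric.ball (WithLp.ofLp ξ₀) ε := by
    rw [ball_pi _ hε]
    exact fun i _ => hy i
  rw [map_zero, ← H y hy']
  congr 2
  exact funext fun i => (hyx i).symm

/-- A compactly supported distribution killed by a nonzero constant coefficient differential
operator is zero. -/
theorem eq_zero_of_smul_eq_zero {V : Set (EuclideanSpace ℝ (Fin n))}
    (hV : Bornology.IsBounded V) {T : Dist n} (hT : AgreeOn T 0 Vᶜ) {a : DiffOps n} (ha : a ≠ 0)
    (h : a • T = 0) : T = 0 := by
  refine DFunLike.ext _ _ fun φ => ?_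
  have hgc := continuous_apply_translate T φ
  have hgi : Integrable fun y => T (translate y φ) :=
    hgc.integrable_of_hasCompactSupport (hasCompactSupport_apply_translate hV hT φ)
  have hcont : Continuous (fourierTranslate φ T) :=
    VectorFourier.fourierIntegral_continuous Real.continuous_fourierChar
      (by exact continuous_inner) hgi
  have hzero : fourierTranslate φ T = 0 := by
    funext ξ₀
    -- The product of the symbol of `a` and the transform is zero. Where the transform is nonzero it
    -- stays so nearby, so the symbol would vanish on an open set.
    by_contra hne
    refine ha (eq_zero_of_eventually_eval_eq_zero a ξ₀ ?_)
    filter_upwards [hcont.continuousAt.eventually_ne hne] with ξ hξ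
    have h1 := fourierTranslate_smul hV hT φ a ξ
    rw [h] at h1
    have h2 : fourierTranslate φ (0 : Dist n) ξ = 0 := by
      have : (fun y => (0 : Dist n) (translate y φ)) = fun _ => (0 : ℂ) := rfl
      simp [fourierTranslate, this, Real.fourier_eq]
    rw [h2] at h1
    exact (mul_eq_zero.1 h1.symm).resolve_right hξ
  have hF : 𝓕 (fun y => T (translate y φ)) = 0 := hzero
  -- Fourier inversion at `y = 0` recovers `T φ`.
  have hinv := hgc.fourierInv_fourier_eq hgi (by rw [hF]; exact integrable_zero _ _ _)
  have h0 := congrFun hinv 0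
  rw [hF, translate_zero] at h0
  rw [← h0]
  change _ = (0 : ℂ)
  simp [Real.fourierInv_eq]

/-! ### Exponential solutions and the converse direction -/

/-- A solution of `∂ᵢ T = λᵢ T` that vanishes on a test function vanishes on its translates. -/
theorem apply_translate_eq_zero {T : Dist n} {l : Fin n → ℂ}
    (hT : ∀ i, (MvPolynomial.X i : DiffOps n) • T = l i • T) {φ : Test n}
    (v : EuclideanSpace ℝ (Fin n)) (h : T (translate v φ) = 0) : T φ = 0 := by
  have hd : ∀ ψ : Test n, negDerivCLM T ψ v = (∑ i, (v i : ℂ) * l i) * T ψ := by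
    intro ψ
    have hv : v = ∑ i, v i • EuclideanSpace.single i (1 : ℝ) := by
      ext j
      simp [Finset.sum_apply, Pi.single_apply]
    conv_lhs => rw [hv]
    rw [map_sum, Finset.sum_mul]
    refine Finset.sum_congr rfl fun i _ => ?_
    have h1 : negDerivCLM T ψ (EuclideanSpace.single i 1) = l i * T ψ := by
      have := congrArg (fun S : Dist n => S ψ) (hT i)
      rwa [X_smul] at this
    rw [map_smul, h1, Complex.real_smul, mul_assoc]
  set μ : ℂ := ∑ i, (v i : ℂ) * l i
  -- Along `t • v` the function satisfies `u' = μ u`, so the integrating factor makes it constant;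
  -- compare `t = 0` and `t = 1`.
  have hderiv : ∀ t : ℝ, HasDerivAt
      (fun t : ℝ => Complex.exp (-(μ * t)) * T (translate (t • v) φ)) 0 t := by
    intro t
    have h1 : HasDerivAt (fun t : ℝ => T (translate (t • v) φ))
        (μ * T (translate (t • v) φ)) t := by
      rw [← hd]
      have h2 : HasDerivAt (fun t : ℝ => t • v) v t := by
        simpa using (hasDerivAt_id t).smul_const v
      exact (hasFDerivAt_translate T φ (t • v)).comp_hasDerivAt t h2
    have h3 : HasDerivAt (fun t : ℝ => Complex.exp (-(μ * t)))
        (Complex.exp (-(μ * t)) * -μ) t := by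
      have h4 : HasDerivAt (fun t : ℝ => -(μ * (t : ℂ))) (-μ) t := by
        have := ((Complex.ofRealCLM.hasDerivAt (x := t)).const_mul μ).neg
        rwa [Complex.ofRealCLM_apply, Complex.ofReal_one, mul_one] at this
      exact h4.cexp
    have h5 := h3.mul h1
    rwa [show Complex.exp (-(μ * t)) * -μ * T (translate (t • v) φ) +
      Complex.exp (-(μ * t)) * (μ * T (translate (t • v) φ)) = 0 by ring] at h5
  have hconst := is_const_of_deriv_eq_zero (fun t => (hderiv t).differentiableAt)
    (fun t => (hderiv t).deriv) 0 1
  simpa [h] using hconst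

/-- A distribution that vanishes on all balls of a fixed radius is zero. -/
theorem eq_zero_of_forall_ball {T : Dist n} {r : ℝ} (hr : 0 < r)
    (h : ∀ x, AgreeOn T 0 (Metric.ball x r)) : T = 0 := by
  refine DFunLike.ext _ _ fun φ => ?_
  obtain ⟨f, hf⟩ := SmoothPartitionOfUnity.exists_isSubordinate
    (modelWithCornersSelf ℝ (EuclideanSpace ℝ (Fin n))) (isClosed_tsupport φ)
    (fun x => Metric.ball x r) (fun _ => Metric.isOpen_ball)
    (fun x _ => Set.mem_iUnion.2 ⟨x, Metric.mem_ball_self hr⟩)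
  let piece : EuclideanSpace ℝ (Fin n) → Test n := fun i =>
    { toFun := fun x => f i x * φ x
      contDiff' := (f i).contMDiff.contDiff.mul φ.contDiff
      hasCompactSupport' := φ.hasCompactSupport.mul_left
      tsupport_subset' := by simp }
  have hfin := f.locallyFinite.finite_nonempty_inter_compact φ.hasCompactSupport.isCompact
  have hsum : φ = ∑ i ∈ hfin.toFinset, piece i := by
    ext x
    have h1 : (∑ i ∈ hfin.toFinset, piece i) x = ∑ i ∈ hfin.toFinset, f i x * φ x := by
      rw [FunLike.coe_sum, Finset.sum_apply]
      rfl
    rw [h1, ← Finset.sum_mul]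
    by_cases hx : x ∈ tsupport φ
    · rw [← finsum_eq_sum_of_support_subset (fun i => f i x), f.sum_eq_one hx, one_mul]
      intro i hi
      simp only [Set.Finite.coe_toFinset]
      exact ⟨x, hi, hx⟩
    · rw [image_eq_zero_of_notMem_tsupport hx, mul_zero]
  rw [hsum, ← distLinear_apply, map_sum]
  refine Finset.sum_eq_zero fun i _ => h i (piece i) ?_
  exact (tsupport_mul_subset_left (f := fun x => f i x)).trans (hf i)

/-- A nonzero exponential solution does not vanish on any nonempty open set. -/
theorem eq_zero_of_agreeOn_zero {T : Dist n} {l : Fin n → ℂ}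
    (hT : ∀ i, (MvPolynomial.X i : DiffOps n) • T = l i • T)
    {W : Set (EuclideanSpace ℝ (Fin n))} (hW : IsOpen W) (hne : W.Nonempty)
    (h : AgreeOn T 0 W) : T = 0 := by
  obtain ⟨w, hw⟩ := hne
  obtain ⟨r, hr, hball⟩ := Metric.isOpen_iff.1 hW w hw
  refine eq_zero_of_forall_ball hr fun x φ hφ => apply_translate_eq_zero hT (w - x) (h _ ?_)
  rw [tsupport_translate]
  refine Set.Subset.trans (fun y hy => ?_) hball
  have := hφ hy
  rw [Metric.mem_ball, dist_eq_norm] at this ⊢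
  rwa [show y - w = y - (w - x) - x by abel]

/-- For a nonzero element `x` of a module `M` and an injective cogenerator `F` there is a map
`M → F` that sends `x` to a nonzero solution of `∂ᵢ T = λᵢ T`. -/
theorem exists_hom_exponential (F : Submodule (DiffOps n) (Dist n))
    (hF : Module.Injective (DiffOps n) F) (hcog : IsCogenerator F)
    {M : Type} [AddCommGroup M] [Module (DiffOps n) M] {x : M} (hx : x ≠ 0) :
    ∃ (ψ : M →ₗ[DiffOps n] F) (l : Fin n → ℂ), ψ x ≠ 0 ∧
      ∀ i, (MvPolynomial.X i : DiffOps n) • (ψ x : Dist n) = l i • (ψ x : Dist n) := by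
  have hI : Ideal.torsionOf (DiffOps n) M x ≠ ⊤ := by
    rwa [Ne, Ideal.torsionOf_eq_top_iff]
  obtain ⟨m, hm, hIm⟩ := Ideal.exists_le_maximal _ hI
  obtain ⟨l, hl⟩ := MvPolynomial.isMaximal_iff_eq_vanishingIdeal_singleton |>.1 hm
  obtain ⟨θ, hθ⟩ := hcog (DiffOps n ⧸ m) (Ideal.Quotient.nontrivial_iff.2 hm.ne_top)
  let e := Ideal.quotTorsionOfEquivSpanSingleton (DiffOps n) M x
  -- `x ↦ θ 1` is well defined on the span of `x`, because the annihilator of `x` lies in `m`.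
  let g : (Submodule.span (DiffOps n) {x}) →ₗ[DiffOps n] F :=
    θ ∘ₗ Submodule.factor hIm ∘ₗ e.symm.toLinearMap
  obtain ⟨ψ, hψ⟩ := hF.out (Submodule.span (DiffOps n) {x}).subtype Subtype.val_injective g
  have hψx : ψ x = θ (Submodule.Quotient.mk 1) := by
    have h1 := hψ ⟨x, Submodule.mem_span_singleton_self x⟩
    have h2 : e.symm ⟨x, Submodule.mem_span_singleton_self x⟩ = Submodule.Quotient.mk 1 := by
      rw [LinearEquiv.symm_apply_eq, Ideal.quotTorsionOfEquivSpanSingleton_apply_mk, one_smul]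
    change ψ x = θ (Submodule.factor hIm (e.symm _)) at h1
    rw [h1, h2]
    rfl
  have hmk : ∀ p : DiffOps n, θ (Submodule.Quotient.mk p) = p • ψ x := by
    intro p
    rw [hψx, ← map_smul, ← Submodule.Quotient.mk_smul, smul_eq_mul, mul_one]
  refine ⟨ψ, l, fun h => hθ ?_, fun i => ?_⟩
  · refine LinearMap.ext fun y => ?_
    obtain ⟨p, rfl⟩ := Submodule.Quotient.mk_surjective _ y
    rw [hmk, h, smul_zero]
    rfl
  · have hmem : (MvPolynomial.X i - MvPolynomial.C (l i) : DiffOps n) ∈ m := by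
      rw [hl, MvPolynomial.mem_vanishingIdeal_singleton_iff]
      simp
    have h1 : (MvPolynomial.X i : DiffOps n) • ψ x =
        (MvPolynomial.C (l i) : DiffOps n) • ψ x := by
      rw [← hmk, ← hmk, (Submodule.Quotient.eq m).2 hmem]
    have h2 := congrArg (Subtype.val : F → Dist n) h1
    rw [← C_smul]
    exact h2

theorem isTorsionFree_of_isControllable (F : Submodule (DiffOps n) (Dist n))
    (hF : Module.Injective (DiffOps n) F) (P : Submodule (DiffOps n) (Fin k → DiffOps n))
    (hloc : HasLocalCutoffs F) (hcog : IsCogenerator F) (hctrl : IsControllable F (ker F P)) :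
    Module.IsTorsionFree (DiffOps n) ((Fin k → DiffOps n) ⧸ P) := by
  rw [Module.isTorsionFree_iff_smul_eq_zero]
  intro a z haz
  by_contra! hne
  obtain ⟨ha, hz⟩ := hne
  obtain ⟨x, rfl⟩ := Submodule.Quotient.mk_surjective _ z
  have hax : a • x ∈ P := (Submodule.Quotient.mk_eq_zero P).1 haz
  obtain ⟨ψ, l, hψ, hl⟩ := exists_hom_exponential F hF hcog hz
  have hfker : (fun j => ψ (Submodule.Quotient.mk (Pi.single j 1))) ∈ ker F P := by
    intro p hp
    rw [← hom_mk_eq_sum, (Submodule.Quotient.mk_eq_zero P).2 hp, map_zero]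
  obtain ⟨U, hU, -, hadm⟩ := hloc (Metric.ball 0 1) Metric.isBounded_ball
    (by rw [Metric.isOpen_ball.interior_eq]; exact Metric.nonempty_ball.2 one_pos)
  obtain ⟨fc, hfc, hcut⟩ := hctrl U _ hadm _ hfker
  have hS := IsCutoff.sum_smul hcut x
  have hT : ∑ j, x j • (ψ (Submodule.Quotient.mk (Pi.single j 1)) : Dist n) =
      ψ (Submodule.Quotient.mk x) := by
    rw [hom_mk_eq_sum]
    push_cast
    rfl
  -- Membership of `fc` in the system, tested on `a • x ∈ P`.
  have haS : a • ∑ j, x j • (fc j : Dist n) = 0 := by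
    have h1 := congrArg (Subtype.val : F → Dist n) (hfc _ hax)
    push_cast at h1
    rw [Finset.smul_sum]
    simpa [mul_smul] using h1
  obtain ⟨⟨W, hWo, hUW, hW⟩, hV⟩ := hS
  have hS0 := eq_zero_of_smul_eq_zero Metric.isBounded_ball hV ha haS
  rw [hT, hS0] at hW
  exact hψ (Subtype.ext (eq_zero_of_agreeOn_zero hl hWo (hU.mono hUW)
    fun φ hφ => (hW φ hφ).symm))

end DistSys

theorem theorem2p1 (n k : ℕ) (F : Submodule (DistSys.DiffOps n) (DistSys.Dist n))
    (hF : Module.Injective (DistSys.DiffOps n) F)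
    (P : Submodule (DistSys.DiffOps n) (Fin k → DistSys.DiffOps n)) :
    (Module.IsTorsionFree (DistSys.DiffOps n) ((Fin k → DistSys.DiffOps n) ⧸ P) →
      DistSys.AdmitsVectorPotential F (DistSys.ker F P) ∧
        DistSys.IsControllable F (DistSys.ker F P)) ∧
    (DistSys.HasLocalCutoffs F → DistSys.IsCogenerator F →
      (DistSys.IsControllable F (DistSys.ker F P) ↔
        Module.IsTorsionFree (DistSys.DiffOps n) ((Fin k → DistSys.DiffOps n) ⧸ P))) := by
  have hfree : Module.IsTorsionFree (DistSys.DiffOps n) ((Fin k → DistSys.DiffOps n) ⧸ P) →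
      DistSys.AdmitsVectorPotential F (DistSys.ker F P) ∧
        DistSys.IsControllable F (DistSys.ker F P) := by
    intro hP
    obtain ⟨m, R, hR⟩ := DistSys.exists_matrix_vecMul_eq_zero_iff P hP
    have hker := DistSys.ker_eq_range_matrixOp F hF P R hR
    exact ⟨⟨m, R, hker⟩, hker ▸ DistSys.isControllable_range_matrixOp F R⟩
  exact ⟨hfree, fun hloc hcog =>
    ⟨DistSys.isTorsionFree_of_isControllable F hF P hloc hcog, fun hP => (hfree hP).2⟩⟩
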